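/- **Conventions.** A functor of two variables between triangulated categories is *exact in each variable* if it is equipped with isomorphisms $F(X,Y[1])\cong F(X,Y)[1]$ and $F(X[1],Y)\cong F(X,Y)[1]$, natural in both $X$ and $Y$, which make each $F(X,-)$ and each $F(-,Y)$ a triangulated functor. A *monoidal triangulated category* is a triangulated category with a monoidal structure whose tensor product is exact in each variable. A *triangulated module category* over a monoidal triangulated category $\mathcal T$ is a triangulated category $\mathcal K$ with a structure of left $\mathcal T$-module category whose module product $\otimes:\mathcal T\times\mathcal K\to\mathcal K$ is exact in each variable. For a t-structure $\mathbb t=(\mathcal C^{\le 0},\mathcal C^{\ge 0})$ on a triangulated category $\mathcal C$, put $\mathcal C^{\le n}=\mathcal C^{\le 0}[-n]$ and $\mathcal C^{\ge n}=\mathcal C^{\ge 0}[-n]$. Its heart is $\mathcal H_{\mathbb t}=\mathcal C^{\le 0}\cap\mathcal C^{\ge 0}$; it is *bounded* if $\bigcup_n\mathcal C^{\le n}=\bigcup_n\mathcal C^{\ge n}=\mathcal C$; and $H^n_{\mathbb t}(X)=\tau_{\le 0}\tau_{\ge 0}(X[n])\in\mathcal H_{\mathbb t}$ for $n\in\mathbb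 Z$, where $\tau_{\le 0},\tau_{\ge 0}$ are the truncation functors of $\mathbb t$. **Proposition.** Let $\mathcal T$ be a monoidal triangulated category with a bounded t-structure $\mathbb t$ which is compatible with the tensor product, that is, $\mathcal H_{\mathbb t}\otimes\mathcal H_{\mathbb t}\subseteq\mathcal H_{\mathbb t}$. Let $\mathcal K$ be a triangulated module category over $\mathcal T$ with a bounded t-structure $\mathbb t'$, and suppose that the module product is compatible with $\mathbb t$ and $\mathbb t'$, that is, $\mathcal H_{\mathbb t}\otimes\mathcal H_{\mathbb t'}\subseteq\mathcal H_{\mathbb t'}$. Then for every integer $n$ and all objects $X\in\mathcal T$, $M\in\mathcal K$, the coproduct below, over all pairs of integers $(p,q)$ with $p+q=n$, exists in $\mathcal H_{\mathbb t'}$, and there is an isomorphism $$H^n_{\mathbb t'}(X\otimes M)\;\cong\;\coprod_{p+q=n}H^p_{\mathbb t}(X)\otimes H^q_{\mathbb t'}(M)$$ in $\mathcal H_{\mathbb t'}$, natural in $X$ and $M$. -/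

import Mathlib

open CategoryTheory Limits Pretriangulated MonoidalCategory
open CategoryTheory.Triangulated
open scoped MonoidalLeftAction

universe v₁ v₂ v₃ u₁ u₂ u₃

noncomputable section

namespace Kunneth

section Biexact

variable {C₁ : Type u₁} [Category.{v₁} C₁] [Preadditive C₁] [HasZeroObject C₁] [HasShift C₁ ℤ]
  [∀ n : ℤ, (shiftFunctor C₁ n).Additive] [Pretriangulated C₁]
  {C₂ : Type u₂} [Category.{v₂} C₂] [Preadditive C₂] [HasZeroObject C₂] [HasShift C₂ ℤ]
  [∀ n : ℤ, (shiftFunctor C₂ n).Additive] [Pretriangulated C₂]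
  {D : Type u₃} [Category.{v₃} D] [Preadditive D] [HasZeroObject D] [HasShift D ℤ]
  [∀ n : ℤ, (shiftFunctor D n).Additive] [Pretriangulated D]

/-- A bifunctor between triangulated categories is exact in each variable: it is equipped with
isomorphisms `G(X, Y[n]) ≅ G(X, Y)[n]` and `G(X[n], Y) ≅ G(X, Y)[n]`, natural in both variables
(and coherent in `n`), for which all `G(X, -)` and all `G(-, Y)` are triangulated functors.
No compatibility between the two families of isomorphisms is imposed. -/
class Biexact (G : C₁ ⥤ C₂ ⥤ D) where
  commShiftObj (X : C₁) : (G.obj X).CommShift ℤ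
  commShift_map {X X' : C₁} (f : X ⟶ X') : NatTrans.CommShift (G.map f) ℤ
  isTriangulated_obj (X : C₁) : (G.obj X).IsTriangulated
  commShiftFlipObj (Y : C₂) : (G.flip.obj Y).CommShift ℤ
  commShift_flip_map {Y Y' : C₂} (g : Y ⟶ Y') : NatTrans.CommShift (G.flip.map g) ℤ
  isTriangulated_flip_obj (Y : C₂) : (G.flip.obj Y).IsTriangulated

end Biexact

section Cohomology

variable {C : Type u₁} [Category.{v₁} C] [Preadditive C] [HasZeroObject C] [HasShift C ℤ]
  [∀ n : ℤ, (shiftFunctor C n).Additive] [Pretriangulated C]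

/-- A t-structure is bounded if every object lies in some `C^{≤ n}` and in some `C^{≥ m}`. -/
def IsBounded (t : TStructure C) : Prop :=
  ∀ X : C, t.bounded X

variable [IsTriangulated C]

/-- The cohomological functor `H⁰ = τ_{≤ 0} τ_{≥ 0} : C ⥤ heart`. -/
def H0 (t : TStructure C) : C ⥤ t.heart.FullSubcategory :=
  t.heart.lift (t.truncGE 0 ⋙ t.truncLE 0) (fun X ↦ (t.mem_heart_iff _).2
    ⟨inferInstanceAs (t.IsLE ((t.truncLE 0).obj ((t.truncGE 0).obj X)) 0),
      inferInstanceAs (t.IsGE ((t.truncLE 0).obj ((t.truncGE 0).obj X)) 0)⟩)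

/-- The cohomology functors `Hⁿ(X) = H⁰(X[n])`. -/
def H (t : TStructure C) (n : ℤ) : C ⥤ t.heart.FullSubcategory :=
  shiftFunctor C n ⋙ H0 t

end Cohomology

section Module

variable (T : Type u₁) [Category.{v₁} T] [Preadditive T] [HasZeroObject T] [HasShift T ℤ]
  [∀ n : ℤ, (shiftFunctor T n).Additive] [Pretriangulated T] [MonoidalCategory T]
  (K : Type u₂) [Category.{v₂} K] [Preadditive K] [HasZeroObject K] [HasShift K ℤ]
  [∀ n : ℤ, (shiftFunctor K n).Additive] [Pretriangulated K]

/-- The tensor product of a monoidal triangulated category `T` is exact in each variable. -/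
abbrev MonoidalTriangulated := Biexact (curriedTensor T)

/-- `K` is a (left) triangulated module category over `T`: the module product
`T × K ⥤ K` is exact in each variable. -/
abbrev TriangulatedModule [MonoidalLeftAction T K] := Biexact (MonoidalLeftAction.curriedAction T K)

variable {T K}

/-- The tensor product of `T` is compatible with `t`: `heart ⊗ heart ⊆ heart`. -/
def TensorCompatible (t : TStructure T) : Prop :=
  ∀ X Y : T, t.heart X → t.heart Y → t.heart (X ⊗ Y)

variable [MonoidalLeftAction T K]

/-- The module product is compatible with `t` and `t'`: `heart ⊗ heart' ⊆ heart'`. -/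
def ActionCompatible (t : TStructure T) (t' : TStructure K) : Prop :=
  ∀ (X : T) (M : K), t.heart X → t'.heart M → t'.heart (X ⊙ₗ M)

variable {t : TStructure T} {t' : TStructure K}

/-- The module product of an object of the heart of `t` and an object of the heart of `t'`,
as an object of the heart of `t'`. -/
def heartAction (h : ActionCompatible t t') (A : t.heart.FullSubcategory)
    (B : t'.heart.FullSubcategory) : t'.heart.FullSubcategory :=
  ⟨A.obj ⊙ₗ B.obj, h _ _ A.property B.property⟩

/-- The functoriality of `heartAction`. -/
def heartActionMap (h : ActionCompatible t t') {A A' : t.heart.FullSubcategory}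
    {B B' : t'.heart.FullSubcategory} (f : A ⟶ A') (g : B ⟶ B') :
    heartAction h A B ⟶ heartAction h A' B' :=
  ObjectProperty.homMk (f.hom ⊙ₗₘ g.hom)

variable [IsTriangulated T] [IsTriangulated K]

/-- The family `Hᵖ(X) ⊗ H^q(M)` of objects of the heart of `t'`, indexed by the pairs
of integers `(p, q)` with `p + q = n`. -/
def summand (h : ActionCompatible t t') (n : ℤ) (X : T) (M : K)
    (pq : {pq : ℤ × ℤ // pq.1 + pq.2 = n}) : t'.heart.FullSubcategory :=
  heartAction h ((H t pq.1.1).obj X) ((H t' pq.1.2).obj M)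

/-- The functoriality of `summand` in both variables. -/
def summandMap (h : ActionCompatible t t') (n : ℤ) {X X' : T} {M M' : K}
    (f : X ⟶ X') (g : M ⟶ M') (pq : {pq : ℤ × ℤ // pq.1 + pq.2 = n}) :
    summand h n X M pq ⟶ summand h n X' M' pq :=
  heartActionMap h ((H t pq.1.1).map f) ((H t' pq.1.2).map g)

end Module

end Kunneth

end

noncomputable section

namespace Kunneth

/-! ### Cohomology of a t-structure: exactness of `H0`, truncation triangles, dévissage. -/

section TStructure

variable {C : Type u₁} [Category.{v₁} C] [Preadditive C] [HasZeroObject C] [HasShift C ℤ]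
  [∀ n : ℤ, (shiftFunctor C n).Additive] [Pretriangulated C] [IsTriangulated C]
  (t : TStructure C)

/-! Dévissage on bounded objects turns heart-compatibility into t-exactness of the module product
`G` in both variables (`IsTExact.of_heart`). Given t-exactness, `H0` of `G(τ_{≤ 0} X, τ_{≤ 0} Y)`
and `H0` of `G(τ_{≥ 0} X, τ_{≥ 0} Y)` are both `G(H⁰ X, H⁰ Y)`, because the error terms live in
degrees `≤ -1` or `≥ 1`. The maps `τ_{≤ 0} ⟶ 𝟭 ⟶ τ_{≥ 0}` therefore exhibit `G(H⁰ X, H⁰ Y)` as a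
natural retract of `H⁰(G(X, Y))`. Shifting the two variables by `p` and `q` gives a retract of
`Hⁿ(G(X, Y))` for each `p + q = n` (`toH`, `fromH`).

Distinct retracts are orthogonal (`toH_comp_fromH_of_ne`): truncating one variable keeps one summand
and kills the other. It remains to see that finitely many of the resulting idempotents add up to the
identity. This is clear when both objects sit in a single degree, and it passes to extensions
(`Decomposes.of_distinguished`): if `e` is the sum, `𝟙 - e` is an idempotent annihilated by `Hⁿ` of
both maps of the triangle, so exactness of `Hⁿ` makes it zero. Since all maps are natural, so is the
decomposition.

Exactness is only needed in the form `comp_eq_zero_of_distinguished`, tested on morphisms from and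
to heart objects, so no kernels or cokernels in the heart are required. -/

instance (B : t.heart.FullSubcategory) : t.IsLE B.obj 0 := ((t.mem_heart_iff _).1 B.property).1

instance (B : t.heart.FullSubcategory) : t.IsGE B.obj 0 := ((t.mem_heart_iff _).1 B.property).2

/-- The canonical morphism `τ_{≤ 0} X ⟶ H⁰(X)`. -/
def truncLEToH0 : t.truncLE 0 ⟶ H0 t ⋙ t.heart.ι :=
  Functor.whiskerRight (t.truncGEπ 0) (t.truncLE 0)

/-- The canonical morphism `H⁰(X) ⟶ τ_{≥ 0} X`. -/
def h0ToTruncGE : H0 t ⋙ t.heart.ι ⟶ t.truncGE 0 :=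
  Functor.whiskerLeft (t.truncGE 0) (t.truncLEι 0)

lemma truncLEToH0_comp_h0ToTruncGE (X : C) :
    (truncLEToH0 t).app X ≫ (h0ToTruncGE t).app X =
      (t.truncLEι 0).app X ≫ (t.truncGEπ 0).app X :=
  (t.truncLEι 0).naturality ((t.truncGEπ 0).app X)

/-- Exactness of `H⁰` in the middle of a distinguished triangle, tested on morphisms from and
to objects of the heart. -/
lemma comp_eq_zero_of_distinguished {X Y Z : C} {u : X ⟶ Y} {v : Y ⟶ Z} {w : Z ⟶ X⟦(1 : ℤ)⟧}
    (hT : Triangle.mk u v w ∈ distTriang C)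
    {A B : t.heart.FullSubcategory} (f : A ⟶ (H0 t).obj Y) (g : (H0 t).obj Y ⟶ B)
    (hf : f ≫ (H0 t).map v = 0) (hg : (H0 t).map u ≫ g = 0) : f ≫ g = 0 := by
  let j : A.obj ⟶ (t.truncGE 0).obj Y := f.hom ≫ (h0ToTruncGE t).app Y
  -- `E` is a homotopy pullback of `A` and `Y` over `τ_{≥ 0} Y`: `f` need not lift to `Y` itself,
  -- but it does after passing to `E`, at the cost of the fibre `τ_{< 0} Y`.
  obtain ⟨E, i, p, hE⟩ := distinguished_cocone_triangle₂ (j ≫ (t.truncGEδLT 0).app Y)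
  obtain ⟨β, hβ⟩ : ∃ β : E ⟶ Y, p ≫ j = β ≫ (t.truncGEπ 0).app Y := by
    obtain ⟨β, -, hβ⟩ := complete_distinguished_triangle_morphism₂ _ _ hE
      (t.triangleLTGE_distinguished 0 Y) (𝟙 _) j
      ((congr_arg ((j ≫ (t.truncGEδLT 0).app Y) ≫ ·)
        ((shiftFunctor C (1 : ℤ)).map_id ((t.truncLT 0).obj Y))).trans
        (Category.comp_id _))
    exact ⟨β, hβ⟩
  have hE0 : t.IsLE E 0 := t.isLE₂ _ hE 0
    (t.isLE_truncLT_obj _ _ _ (by lia)) (inferInstanceAs (t.IsLE A.obj 0))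
  have hβv : (β ≫ v) ≫ (t.truncGEπ 0).app Z = 0 := by
    have h₁ : v ≫ (t.truncGEπ 0).app Z = (t.truncGEπ 0).app Y ≫ (t.truncGE 0).map v :=
      (t.truncGEπ 0).naturality v
    have h₂ : ((H0 t).map v).hom ≫ (h0ToTruncGE t).app Z =
      (h0ToTruncGE t).app Y ≫ (t.truncGE 0).map v := (h0ToTruncGE t).naturality v
    have h₃ : f.hom ≫ ((H0 t).map v).hom = 0 := congr_arg InducedCategory.Hom.hom hf
    rw [Category.assoc, h₁, ← reassoc_of% hβ]
    simp only [j, Category.assoc]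
    rw [← h₂, reassoc_of% h₃, zero_comp, comp_zero]
  obtain ⟨k, hk⟩ : ∃ k : E ⟶ (t.truncLT 0).obj Z, β ≫ v = k ≫ (t.truncLTι 0).app Z :=
    Triangle.coyoneda_exact₂ _ (t.triangleLTGE_distinguished 0 Z) _ hβv
  -- On the fibre `F` of `k` the obstruction to lifting `β` along `u` vanishes. `F` stays in degrees
  -- `≤ 0`, since it differs from `E` only by `(τ_{< 0} Z)[-1]`.
  obtain ⟨F, q, d, hF⟩ := distinguished_cocone_triangle₁ k
  have hZ1 : t.IsLE ((t.truncLT 0).obj Z) (-1) := t.isLE_truncLT_obj ..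
  have hY1 : t.IsLE ((t.truncLT 0).obj Y) (-1) := t.isLE_truncLT_obj ..
  have hF0 : t.IsLE F 0 := t.isLE₂ _ (inv_rot_of_distTriang _ hF) 0
    (t.isLE_shift ((t.truncLT 0).obj Z) (-1) (-1) 0) hE0
  have hqk : q ≫ k = 0 := comp_distTriang_mor_zero₁₂ _ hF
  obtain ⟨s, hs⟩ : ∃ s : F ⟶ X, q ≫ β = s ≫ u :=
    Triangle.coyoneda_exact₂ _ hT (q ≫ β) (by
      change (q ≫ β) ≫ v = 0
      rw [Category.assoc, hk, reassoc_of% hqk, zero_comp])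
  have hβ' : t.liftTruncLE β 0 ≫ (truncLEToH0 t).app Y = p ≫ f.hom := by
    have h₁ := truncLEToH0_comp_h0ToTruncGE t Y
    have h₂ : (t.liftTruncLE β 0 ≫ (truncLEToH0 t).app Y) ≫ (h0ToTruncGE t).app Y =
        (p ≫ f.hom) ≫ (h0ToTruncGE t).app Y := by
      rw [Category.assoc, h₁, TStructure.liftTruncLE_ι_assoc, ← hβ, Category.assoc]
    exact t.to_truncLE_obj_ext (n := 0) (X := (t.truncGE 0).obj Y) h₂
  have hs' : q ≫ t.liftTruncLE β 0 = t.liftTruncLE s 0 ≫ (t.truncLE 0).map u := by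
    refine t.to_truncLE_obj_ext ?_
    simp [hs]
  have h₁ : (t.truncLE 0).map u ≫ (truncLEToH0 t).app Y =
      (truncLEToH0 t).app X ≫ ((H0 t).map u).hom := (truncLEToH0 t).naturality u
  have h₂ : ((H0 t).map u).hom ≫ g.hom = 0 := congr_arg InducedCategory.Hom.hom hg
  have hq : q ≫ p ≫ f.hom ≫ g.hom = 0 := by
    rw [← reassoc_of% hβ', reassoc_of% hs', reassoc_of% h₁, h₂, comp_zero, comp_zero]
  obtain ⟨z, hz⟩ : ∃ z : (t.truncLT 0).obj Z ⟶ B.obj, p ≫ f.hom ≫ g.hom = k ≫ z :=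
    Triangle.yoneda_exact₂ _ hF _ hq
  -- The two corrections are now removed: `p ≫ f ≫ g` factors through `τ_{< 0} Z`, and then `f ≫ g`
  -- through `(τ_{< 0} Y)[1]`; neither maps nontrivially to the heart.
  rw [t.zero z (-1) 0, comp_zero] at hz
  obtain ⟨z', hz'⟩ : ∃ z' : ((t.truncLT 0).obj Y)⟦(1 : ℤ)⟧ ⟶ B.obj,
      f.hom ≫ g.hom = (j ≫ (t.truncGEδLT 0).app Y) ≫ z' :=
    Triangle.yoneda_exact₃ _ hE (f.hom ≫ g.hom) hz
  have : t.IsLE (((t.truncLT 0).obj Y)⟦(1 : ℤ)⟧) (-2) := t.isLE_shift _ (-1) 1 (-2)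
  rw [t.zero z' (-2) 0, comp_zero] at hz'
  ext
  exact hz'

/-- The isomorphism `H⁰(B) ≅ B` for an object `B` of the heart. -/
def h0ObjIso (B : t.heart.FullSubcategory) :
    (t.truncLE 0).obj ((t.truncGE 0).obj B.obj) ≅ B.obj :=
  have : IsIso ((t.truncLEι 0).app ((t.truncGE 0).obj B.obj)) :=
    (t.isLE_iff_isIso_truncLEι_app 0 _).1 inferInstance
  asIso ((t.truncLEι 0).app ((t.truncGE 0).obj B.obj)) ≪≫ (asIso ((t.truncGEπ 0).app B.obj)).symm

/-- On the heart, `H⁰` is isomorphic to the identity. -/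
def ιCompH0Iso : t.heart.ι ⋙ H0 t ≅ 𝟭 _ :=
  NatIso.ofComponents (fun B ↦ t.heart.isoMk (h0ObjIso t B)) (by
    intro B B' f
    ext
    have h₁ := (t.truncLEι 0).naturality ((t.truncGE 0).map f.hom)
    have h₂ : f.hom ≫ (t.truncGEπ 0).app B'.obj =
      (t.truncGEπ 0).app B.obj ≫ (t.truncGE 0).map f.hom := (t.truncGEπ 0).naturality f.hom
    change (t.truncLE 0).map ((t.truncGE 0).map f.hom) ≫
      (t.truncLEι 0).app ((t.truncGE 0).obj B'.obj) ≫ inv ((t.truncGEπ 0).app B'.obj) =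
      ((t.truncLEι 0).app ((t.truncGE 0).obj B.obj) ≫ inv ((t.truncGEπ 0).app B.obj)) ≫ f.hom
    rw [reassoc_of% h₁, Category.assoc]
    congr 1
    rw [IsIso.eq_inv_comp, ← reassoc_of% h₂, IsIso.hom_inv_id, Category.comp_id])

instance : (H0 t).Additive where
  map_add {X Y f g} := by
    ext
    exact ((t.truncGE 0 ⋙ t.truncLE 0).map_add : _ = _)

lemma isIso_H0_map_of_isLE {X Y Z : C} {u : X ⟶ Y} {v : Y ⟶ Z} {w : Z ⟶ X⟦(1 : ℤ)⟧}
    (hT : Triangle.mk u v w ∈ distTriang C) (hX : t.IsLE X (-1)) : IsIso ((H0 t).map v) := by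
  have : IsIso ((t.truncGE 0).map v) := t.isIso₂_truncGE_map_of_isLE _ hT (-1) 0 (by lia) hX
  rw [← ObjectProperty.isIso_hom_iff]
  exact inferInstanceAs (IsIso ((t.truncLE 0).map ((t.truncGE 0).map v)))

/-- Here it is `τ_{≤ 0}` that inverts `u`, while `H0` applies `τ_{≥ 0}` first; the interchange of
the two truncations bridges the gap. -/
lemma isIso_H0_map_of_isGE {X Y Z : C} {u : X ⟶ Y} {v : Y ⟶ Z} {w : Z ⟶ X⟦(1 : ℤ)⟧}
    (hT : Triangle.mk u v w ∈ distTriang C) (hZ : t.IsGE Z 1) : IsIso ((H0 t).map u) := by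
  have : IsIso ((t.truncLE 0).map u) := t.isIso₁_truncLE_map_of_isGE _ hT 0 1 (by lia) hZ
  rw [← ObjectProperty.isIso_hom_iff]
  exact (NatIso.isIso_map_iff (t.truncGELEIsoLEGE 0 0) u).1
    (inferInstanceAs (IsIso ((t.truncGE 0).map ((t.truncLE 0).map u))))

omit [IsTriangulated C] in
lemma isZero_of_isZero_obj {B : t.heart.FullSubcategory} (hB : IsZero B.obj) : IsZero B := by
  rw [IsZero.iff_id_eq_zero] at hB ⊢
  ext
  exact hB

lemma isZero_H0_obj_of_isLE (X : C) (n : ℤ) (hn : n < 0) [t.IsLE X n] :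
    IsZero ((H0 t).obj X) := by
  have := t.isLE_of_le X n (-1)
  exact isZero_of_isZero_obj t ((t.truncLE 0).map_isZero
    (t.isZero_truncGE_obj_of_isLE (-1) 0 (by lia) X))

lemma isZero_H0_obj_of_isGE (X : C) (n : ℤ) (hn : 0 < n) [t.IsGE X n] :
    IsZero ((H0 t).obj X) := by
  have := t.isGE_of_ge X 1 n
  have : t.IsGE ((t.truncGE 0).obj X) 1 := inferInstance
  exact isZero_of_isZero_obj t (t.isZero_truncLE_obj_of_isGE 0 1 (by lia) _)

/-- Interchanging truncations identifies `H⁰(X)` with `τ_{≥ 0} τ_{≤ 0} X`, so the map is a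
truncation map with fibre `τ_{< 0} τ_{≤ 0} X`. -/
lemma exists_distinguished_truncLEToH0 (X : C) :
    ∃ (F : C) (f : F ⟶ (t.truncLE 0).obj X) (h : ((H0 t).obj X).obj ⟶ F⟦(1 : ℤ)⟧),
      Triangle.mk f ((truncLEToH0 t).app X) h ∈ distTriang C ∧ t.IsLE F (-1) := by
  let e := (t.truncGELEIsoLEGE 0 0).app X
  have he : (t.truncGEπ 0).app ((t.truncLE 0).obj X) ≫ e.hom = (truncLEToH0 t).app X := by
    refine t.to_truncLE_obj_ext (n := 0) (Y := (t.truncLE 0).obj X) (X := (t.truncGE 0).obj X) ?_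
    have h₁ := truncLEToH0_comp_h0ToTruncGE t X
    have h₂ := t.truncGELTToLTGE_app_pentagon 0 (0 + 1) X
    rw [Category.assoc]
    exact h₂.trans h₁.symm
  refine ⟨_, (t.truncLTι 0).app ((t.truncLE 0).obj X),
    e.inv ≫ (t.truncGEδLT 0).app ((t.truncLE 0).obj X), ?_, t.isLE_truncLT_obj ..⟩
  refine isomorphic_distinguished _ (t.triangleLTGE_distinguished 0 ((t.truncLE 0).obj X)) _ ?_
  refine Triangle.isoMk _ _ (Iso.refl _) (Iso.refl _) e.symm
    ((Category.comp_id _).trans (Category.id_comp _).symm)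
    (((Iso.eq_comp_inv e).2 he).symm.trans (Category.id_comp _).symm) ?_
  exact (congr_arg ((e.inv ≫ (t.truncGEδLT 0).app ((t.truncLE 0).obj X)) ≫ ·)
    ((shiftFunctor C (1 : ℤ)).map_id ((t.truncLT 0).obj ((t.truncLE 0).obj X)))).trans
      (Category.comp_id _)

lemma exists_distinguished_h0ToTruncGE (X : C) :
    ∃ (Z : C) (g : (t.truncGE 0).obj X ⟶ Z) (h : Z ⟶ ((H0 t).obj X).obj⟦(1 : ℤ)⟧),
      Triangle.mk ((h0ToTruncGE t).app X) g h ∈ distTriang C ∧ t.IsGE Z 1 :=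
  ⟨_, _, _, t.triangleLEGE_distinguished 0 1 (by lia) ((t.truncGE 0).obj X),
    t.isGE_truncGE_obj ..⟩

/-- To prove a property of objects with cohomology in degrees between `a` and `b` which is stable
under extensions, it suffices to consider objects concentrated in a single degree. -/
lemma of_isGE_of_isLE (P : ObjectProperty C)
    (hP : ∀ (T : Triangle C), T ∈ distTriang C → P T.obj₁ → P T.obj₃ → P T.obj₂)
    (a b : ℤ)
    (h : ∀ (c : ℤ) (_ : a ≤ c) (_ : c ≤ b) (X : C) [t.IsGE X c] [t.IsLE X c], P X)
    (h₀ : ∀ X : C, IsZero X → P X)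
    (X : C) [t.IsGE X a] [t.IsLE X b] : P X := by
  -- Induction on the width of the interval `[a, b]`, splitting off the top degree `b` by
  -- truncation; an empty interval forces `X` to be zero.
  obtain ⟨k, hk⟩ : ∃ k : ℕ, b - a < k := ⟨(b - a).toNat + 1, by lia⟩
  induction k generalizing b X with
  | zero => exact h₀ _ (t.isZero X b a)
  | succ k hk' =>
    by_cases hab : b < a
    · exact h₀ _ (t.isZero X b a)
    have : t.IsLE ((t.truncLT b).obj X) (b - 1) := t.isLE_truncLT_obj ..
    refine hP _ (t.triangleLTGE_distinguished b X) ?_ ?_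
    · exact hk' (b - 1) (fun c hc hc' ↦ h c hc (by lia)) ((t.truncLT b).obj X) (by lia)
    · exact h b (by lia) le_rfl ((t.truncGE b).obj X)

end TStructure

/-! ### Bifunctors acting on pairs of morphisms. -/

section Bimap

variable {C₁ : Type u₁} [Category.{v₁} C₁] {C₂ : Type u₂} [Category.{v₂} C₂]
  {D : Type u₃} [Category.{v₃} D] (G : C₁ ⥤ C₂ ⥤ D)

/-- The morphism `G(X, Y) ⟶ G(X', Y')` induced by `X ⟶ X'` and `Y ⟶ Y'`. -/
def bimap {X X' : C₁} {Y Y' : C₂} (f : X ⟶ X') (g : Y ⟶ Y') :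
    (G.obj X).obj Y ⟶ (G.obj X').obj Y' :=
  (G.map f).app Y ≫ (G.obj X').map g

lemma bimap_id_right {X X' : C₁} (f : X ⟶ X') (Y : C₂) :
    bimap G f (𝟙 Y) = (G.map f).app Y := by
  simp [bimap]

lemma bimap_id_left (X : C₁) {Y Y' : C₂} (g : Y ⟶ Y') :
    bimap G (𝟙 X) g = (G.obj X).map g := by
  simp [bimap]

lemma bimap_comp {X X' X'' : C₁} {Y Y' Y'' : C₂} (f : X ⟶ X') (f' : X' ⟶ X'')
    (g : Y ⟶ Y') (g' : Y' ⟶ Y'') :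
    bimap G (f ≫ f') (g ≫ g') = bimap G f g ≫ bimap G f' g' := by
  simp [bimap]

instance isIso_bimap {X X' : C₁} {Y Y' : C₂} (f : X ⟶ X') (g : Y ⟶ Y') [IsIso f] [IsIso g] :
    IsIso (bimap G f g) := by
  dsimp [bimap]
  infer_instance

end Bimap

/-! ### Biexact bifunctors: shifts, triangles, and t-exactness from the hearts. -/

section Biexact

variable {C₁ : Type u₁} [Category.{v₁} C₁] [Preadditive C₁] [HasZeroObject C₁] [HasShift C₁ ℤ]
  [∀ n : ℤ, (shiftFunctor C₁ n).Additive] [Pretriangulated C₁]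
  {C₂ : Type u₂} [Category.{v₂} C₂] [Preadditive C₂] [HasZeroObject C₂] [HasShift C₂ ℤ]
  [∀ n : ℤ, (shiftFunctor C₂ n).Additive] [Pretriangulated C₂]
  {D : Type u₃} [Category.{v₃} D] [Preadditive D] [HasZeroObject D] [HasShift D ℤ]
  [∀ n : ℤ, (shiftFunctor D n).Additive] [Pretriangulated D]
  (G : C₁ ⥤ C₂ ⥤ D) [Biexact G]

instance (X : C₁) : (G.obj X).CommShift ℤ := Biexact.commShiftObj X

instance {X X' : C₁} (f : X ⟶ X') : NatTrans.CommShift (G.map f) ℤ := Biexact.commShift_map f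

instance (X : C₁) : (G.obj X).IsTriangulated := Biexact.isTriangulated_obj X

instance (Y : C₂) : (G.flip.obj Y).CommShift ℤ := Biexact.commShiftFlipObj Y

instance {Y Y' : C₂} (g : Y ⟶ Y') : NatTrans.CommShift (G.flip.map g) ℤ :=
  Biexact.commShift_flip_map g

instance (Y : C₂) : (G.flip.obj Y).IsTriangulated := Biexact.isTriangulated_flip_obj Y

/-- The isomorphism `G(X, Y[q]) ≅ G(X, Y)[q]`. -/
def shiftRightIso (q : ℤ) (X : C₁) (Y : C₂) :
    (G.obj X).obj (Y⟦q⟧) ≅ ((G.obj X).obj Y)⟦q⟧ :=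
  ((G.obj X).commShiftIso q).app Y

lemma shiftRightIso_hom_naturality (q : ℤ) {X X' : C₁} {Y Y' : C₂} (f : X ⟶ X') (g : Y ⟶ Y') :
    bimap G f (g⟦q⟧') ≫ (shiftRightIso G q X' Y').hom =
      (shiftRightIso G q X Y).hom ≫ (bimap G f g)⟦q⟧' := by
  have h₁ : (G.map f).app (Y⟦q⟧) ≫ (shiftRightIso G q X' Y).hom =
      (shiftRightIso G q X Y).hom ≫ ((G.map f).app Y)⟦q⟧' :=
    (NatTrans.shift_app_comm (G.map f) q Y).symm
  have h₂ : (G.obj X').map (g⟦q⟧') ≫ (shiftRightIso G q X' Y').hom =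
      (shiftRightIso G q X' Y).hom ≫ ((G.obj X').map g)⟦q⟧' :=
    ((G.obj X').commShiftIso q).hom.naturality g
  simp only [bimap, Category.assoc, Functor.map_comp]
  rw [h₂, reassoc_of% h₁]

/-- The isomorphism `G(X[p], Y) ≅ G(X, Y)[p]`. -/
def shiftLeftIso (p : ℤ) (X : C₁) (Y : C₂) :
    (G.obj (X⟦p⟧)).obj Y ≅ ((G.obj X).obj Y)⟦p⟧ :=
  ((G.flip.obj Y).commShiftIso p).app X

lemma shiftLeftIso_hom_naturality (p : ℤ) {X X' : C₁} {Y Y' : C₂} (f : X ⟶ X') (g : Y ⟶ Y') :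
    bimap G (f⟦p⟧') g ≫ (shiftLeftIso G p X' Y').hom =
      (shiftLeftIso G p X Y).hom ≫ (bimap G f g)⟦p⟧' := by
  have h₁ : (G.obj (X'⟦p⟧)).map g ≫ (shiftLeftIso G p X' Y').hom =
      (shiftLeftIso G p X' Y).hom ≫ ((G.obj X').map g)⟦p⟧' :=
    (NatTrans.shift_app_comm (G.flip.map g) p X').symm
  have h₂ : (G.map (f⟦p⟧')).app Y ≫ (shiftLeftIso G p X' Y).hom =
      (shiftLeftIso G p X Y).hom ≫ ((G.map f).app Y)⟦p⟧' :=
    ((G.flip.obj Y).commShiftIso p).hom.naturality f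
  simp only [bimap, Category.assoc, Functor.map_comp]
  rw [h₁, reassoc_of% h₂]

/-- The isomorphism `G(X[p], Y[q]) ≅ G(X, Y)[n]` for `p + q = n`. -/
def shiftIso (p q n : ℤ) (h : p + q = n) (X : C₁) (Y : C₂) :
    (G.obj (X⟦p⟧)).obj (Y⟦q⟧) ≅ ((G.obj X).obj Y)⟦n⟧ :=
  shiftRightIso G q (X⟦p⟧) Y ≪≫ (shiftFunctor D q).mapIso (shiftLeftIso G p X Y) ≪≫
    (shiftFunctorAdd' D p q n h).symm.app _

/-- Apart from invertibility, naturality is all that is used of `shiftIso`. The order of extracting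
the two shifts is fixed once and for all, so the sign relating the two orders never arises. -/
lemma shiftIso_hom_naturality (p q n : ℤ) (h : p + q = n) {X X' : C₁} {Y Y' : C₂}
    (f : X ⟶ X') (g : Y ⟶ Y') :
    bimap G (f⟦p⟧') (g⟦q⟧') ≫ (shiftIso G p q n h X' Y').hom =
      (shiftIso G p q n h X Y).hom ≫ (bimap G f g)⟦n⟧' := by
  have h₁ : (bimap G f g)⟦p⟧'⟦q⟧' ≫ (shiftFunctorAdd' D p q n h).inv.app _ =
      (shiftFunctorAdd' D p q n h).inv.app _ ≫ (bimap G f g)⟦n⟧' :=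
    (shiftFunctorAdd' D p q n h).inv.naturality (bimap G f g)
  have h₂ := congr_arg (fun k ↦ k⟦q⟧') (shiftLeftIso_hom_naturality G p f g)
  simp only [Functor.map_comp] at h₂
  dsimp only [shiftIso, Iso.trans_hom, Functor.mapIso_hom, Iso.app_hom, Iso.symm_hom]
  rw [reassoc_of% shiftRightIso_hom_naturality, reassoc_of% h₂, h₁]
  simp only [Category.assoc]

lemma exists_distinguished_left {X X' X'' : C₁} {u : X ⟶ X'} {v : X' ⟶ X''} {w : X'' ⟶ X⟦(1 : ℤ)⟧}
    (hT : Triangle.mk u v w ∈ distTriang C₁) (Y : C₂) :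
    ∃ w' : (G.obj X'').obj Y ⟶ ((G.obj X).obj Y)⟦(1 : ℤ)⟧,
      Triangle.mk (bimap G u (𝟙 Y)) (bimap G v (𝟙 Y)) w' ∈ distTriang D := by
  rw [bimap_id_right, bimap_id_right]
  exact ⟨_, (G.flip.obj Y).map_distinguished _ hT⟩

lemma exists_distinguished_right (X : C₁) {Y Y' Y'' : C₂} {u : Y ⟶ Y'} {v : Y' ⟶ Y''}
    {w : Y'' ⟶ Y⟦(1 : ℤ)⟧} (hT : Triangle.mk u v w ∈ distTriang C₂) :
    ∃ w' : (G.obj X).obj Y'' ⟶ ((G.obj X).obj Y)⟦(1 : ℤ)⟧,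
      Triangle.mk (bimap G (𝟙 X) u) (bimap G (𝟙 X) v) w' ∈ distTriang D := by
  rw [bimap_id_left, bimap_id_left]
  exact ⟨_, (G.obj X).map_distinguished _ hT⟩

lemma isZero_obj_obj_left {X : C₁} (hX : IsZero X) (Y : C₂) : IsZero ((G.obj X).obj Y) :=
  (G.flip.obj Y).map_isZero hX

lemma isZero_obj_obj_right (X : C₁) {Y : C₂} (hY : IsZero Y) : IsZero ((G.obj X).obj Y) :=
  (G.obj X).map_isZero hY

/-- A bifunctor is t-exact if it sends objects in degrees `≤ a` and `≤ b` to objects in degrees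
`≤ a + b`, and objects in degrees `≥ a` and `≥ b` to objects in degrees `≥ a + b`. -/
class IsTExact (G : C₁ ⥤ C₂ ⥤ D) (t₁ : TStructure C₁) (t₂ : TStructure C₂)
    (t : TStructure D) : Prop where
  isLE (a b : ℤ) (X : C₁) (Y : C₂) [t₁.IsLE X a] [t₂.IsLE Y b] : t.IsLE ((G.obj X).obj Y) (a + b)
  isGE (a b : ℤ) (X : C₁) (Y : C₂) [t₁.IsGE X a] [t₂.IsGE Y b] : t.IsGE ((G.obj X).obj Y) (a + b)

variable {t₁ : TStructure C₁} {t₂ : TStructure C₂} {t : TStructure D}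

/-- Shifting `X` by `a` and `Y` by `b` lands in the hearts, and `shiftIso` moves both shifts
outside. -/
lemma isLE_and_isGE_of_heart
    (hG : ∀ (X : C₁) (Y : C₂), t₁.heart X → t₂.heart Y → t.heart ((G.obj X).obj Y))
    (a b : ℤ) (X : C₁) (Y : C₂) [t₁.IsLE X a] [t₁.IsGE X a] [t₂.IsLE Y b] [t₂.IsGE Y b] :
    t.IsLE ((G.obj X).obj Y) (a + b) ∧ t.IsGE ((G.obj X).obj Y) (a + b) := by
  have h := t.heart.prop_of_iso (shiftIso G a b (a + b) rfl X Y)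
    (hG _ _ ((t₁.mem_heart_iff _).2 ⟨t₁.isLE_shift X a a 0, t₁.isGE_shift X a a 0⟩)
      ((t₂.mem_heart_iff _).2 ⟨t₂.isLE_shift Y b b 0, t₂.isGE_shift Y b b 0⟩))
  obtain ⟨_, _⟩ := (t.mem_heart_iff _).1 h
  exact ⟨t.isLE_of_shift _ (a + b) (a + b) 0, t.isGE_of_shift _ (a + b) (a + b) 0⟩

variable [IsTriangulated C₁] [IsTriangulated C₂]

/-- Dévissage in `X`, then in `Y`, reduces to objects in a single degree. Boundedness supplies the
opposite bound needed to start each dévissage. -/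
lemma IsTExact.of_heart (ht₁ : IsBounded t₁) (ht₂ : IsBounded t₂)
    (hG : ∀ (X : C₁) (Y : C₂), t₁.heart X → t₂.heart Y → t.heart ((G.obj X).obj Y)) :
    IsTExact G t₁ t₂ t where
  isLE a b X Y _ _ := by
    obtain ⟨a', _⟩ := (ht₁ X).1
    obtain ⟨b', _⟩ := (ht₂ Y).1
    refine of_isGE_of_isLE t₁ (fun X ↦ t.IsLE ((G.obj X).obj Y) (a + b)) ?_ a' a ?_ ?_ X
    · intro T hT h₁ h₃
      obtain ⟨w, hw⟩ := exists_distinguished_left G hT Y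
      exact t.isLE₂ _ hw _ h₁ h₃
    · intro c _ hc X _ _
      refine of_isGE_of_isLE t₂ (fun Y ↦ t.IsLE ((G.obj X).obj Y) (a + b)) ?_ b' b ?_ ?_ Y
      · intro T hT h₁ h₃
        obtain ⟨w, hw⟩ := exists_distinguished_right G X hT
        exact t.isLE₂ _ hw _ h₁ h₃
      · intro d _ hd Y _ _
        have := (isLE_and_isGE_of_heart G hG c d X Y).1
        exact t.isLE_of_le _ (c + d) _
      · exact fun Y hY ↦ t.isLE_of_isZero (isZero_obj_obj_right G X hY) _
    · exact fun X hX ↦ t.isLE_of_isZero (isZero_obj_obj_left G hX Y) _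
  isGE a b X Y _ _ := by
    obtain ⟨a', _⟩ := (ht₁ X).2
    obtain ⟨b', _⟩ := (ht₂ Y).2
    refine of_isGE_of_isLE t₁ (fun X ↦ t.IsGE ((G.obj X).obj Y) (a + b)) ?_ a a' ?_ ?_ X
    · intro T hT h₁ h₃
      obtain ⟨w, hw⟩ := exists_distinguished_left G hT Y
      exact t.isGE₂ _ hw _ h₁ h₃
    · intro c _ hc X _ _
      refine of_isGE_of_isLE t₂ (fun Y ↦ t.IsGE ((G.obj X).obj Y) (a + b)) ?_ b b' ?_ ?_ Y
      · intro T hT h₁ h₃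
        obtain ⟨w, hw⟩ := exists_distinguished_right G X hT
        exact t.isGE₂ _ hw _ h₁ h₃
      · intro d _ hd Y _ _
        have := (isLE_and_isGE_of_heart G hG c d X Y).2
        exact t.isGE_of_ge _ _ (c + d)
      · exact fun Y hY ↦ t.isGE_of_isZero (isZero_obj_obj_right G X hY) _
    · exact fun X hX ↦ t.isGE_of_isZero (isZero_obj_obj_left G hX Y) _

end Biexact

/-! ### Coproducts from orthogonal idempotents with finite sum. -/

section Decomposition

variable {A : Type u₁} [Category.{v₁} A] [Preadditive A] {I : Type u₂} {S : I → A} {Y : A}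
  {φ : ∀ i, S i ⟶ Y} {ψ : ∀ i, Y ⟶ S i}

/-- If `φ i : S i ⟶ Y` and `ψ i : Y ⟶ S i` are orthogonal and finitely many of the idempotents
`ψ i ≫ φ i` sum up to the identity, then `Y` is the coproduct of the family `S`. -/
def isColimitOfSumEqId (hφψ : ∀ i, φ i ≫ ψ i = 𝟙 _) (hφψ' : ∀ i j, i ≠ j → φ i ≫ ψ j = 0)
    (s : Finset I) (hs : ∑ i ∈ s, ψ i ≫ φ i = 𝟙 Y) : IsColimit (Cofan.mk Y φ) :=
  have key (i : I) {Z : A} (c : ∀ i, S i ⟶ Z) : φ i ≫ ∑ j ∈ s, ψ j ≫ c j = c i := by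
    rw [Preadditive.comp_sum]
    by_cases hi : i ∈ s
    · rw [Finset.sum_eq_single_of_mem i hi (fun j _ hj ↦ by rw [reassoc_of% hφψ' i j hj.symm,
        zero_comp]), reassoc_of% hφψ i]
    -- An index outside `s` must have `S i` zero: inserting the sum between `φ i` and `ψ i` kills
    -- every term. This is why a possibly infinite family is still a coproduct.
    · have h₀ : 𝟙 (S i) = 0 := by
        rw [← hφψ i, ← Category.id_comp (ψ i), ← hs, Preadditive.sum_comp, Preadditive.comp_sum]
        refine Finset.sum_eq_zero fun j hj ↦ ?_
        have : i ≠ j := by rintro rfl; exact hi hj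
        rw [Category.assoc, reassoc_of% hφψ' i j this, zero_comp]
      rw [Finset.sum_eq_zero fun j hj ↦ ?_, ← Category.id_comp (c i), h₀, zero_comp]
      have : i ≠ j := by rintro rfl; exact hi hj
      rw [reassoc_of% hφψ' i j this, zero_comp]
  Cofan.IsColimit.mk _ (fun c ↦ ∑ j ∈ s, ψ j ≫ c.inj j) (fun c i ↦ key i c.inj) (fun c m hm ↦ by
    rw [← Category.id_comp m]
    change 𝟙 Y ≫ m = _
    rw [← hs, Preadditive.sum_comp]
    refine Finset.sum_congr rfl fun j _ ↦ ?_
    rw [Category.assoc]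
    exact congr_arg (ψ j ≫ ·) (hm j))

/-- For `i` outside `s`, `φ i` is orthogonal to every term of a sum equal to the identity, hence
zero. This allows enlarging two finite index sets to a common one. -/
lemma sum_eq_id_of_subset (hφψ' : ∀ i j, i ≠ j → φ i ≫ ψ j = 0)
    {s s' : Finset I} (hss' : s ⊆ s') (hs : ∑ i ∈ s, ψ i ≫ φ i = 𝟙 Y) :
    ∑ i ∈ s', ψ i ≫ φ i = 𝟙 Y := by
  rw [← hs]
  refine (Finset.sum_subset hss' fun i _ hi ↦ ?_).symm
  rw [← Category.comp_id (φ i), ← hs, Preadditive.comp_sum, Preadditive.comp_sum]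
  refine Finset.sum_eq_zero fun j hj ↦ ?_
  have : i ≠ j := by rintro rfl; exact hi hj
  rw [reassoc_of% hφψ' i j this, zero_comp, comp_zero]

lemma sum_comp_sum (hφψ : ∀ i, φ i ≫ ψ i = 𝟙 _) (hφψ' : ∀ i j, i ≠ j → φ i ≫ ψ j = 0)
    (s : Finset I) :
    (∑ i ∈ s, ψ i ≫ φ i) ≫ ∑ i ∈ s, ψ i ≫ φ i = ∑ i ∈ s, ψ i ≫ φ i := by
  rw [Preadditive.sum_comp]
  refine Finset.sum_congr rfl fun i hi ↦ ?_
  rw [Preadditive.comp_sum, Finset.sum_eq_single_of_mem i hi fun j _ hj ↦ ?_]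
  · rw [Category.assoc, reassoc_of% hφψ i]
  · rw [Category.assoc, reassoc_of% hφψ' i j hj.symm, zero_comp, comp_zero]

end Decomposition

/-! ### The degree-zero retract `G(H⁰ X, H⁰ Y)` of `H⁰(G(X, Y))`. -/

section Kunneth

variable {C₁ : Type u₁} [Category.{v₁} C₁] [Preadditive C₁] [HasZeroObject C₁] [HasShift C₁ ℤ]
  [∀ n : ℤ, (shiftFunctor C₁ n).Additive] [Pretriangulated C₁] [IsTriangulated C₁]
  {C₂ : Type u₂} [Category.{v₂} C₂] [Preadditive C₂] [HasZeroObject C₂] [HasShift C₂ ℤ]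
  [∀ n : ℤ, (shiftFunctor C₂ n).Additive] [Pretriangulated C₂] [IsTriangulated C₂]
  {D : Type u₃} [Category.{v₃} D] [Preadditive D] [HasZeroObject D] [HasShift D ℤ]
  [∀ n : ℤ, (shiftFunctor D n).Additive] [Pretriangulated D] [IsTriangulated D]
  (G : C₁ ⥤ C₂ ⥤ D) [Biexact G]
  (t₁ : TStructure C₁) (t₂ : TStructure C₂) (t : TStructure D) [IsTExact G t₁ t₂ t]

omit [IsTriangulated C₁] [IsTriangulated C₂] [IsTriangulated D] [Biexact G] in
lemma heart_obj_obj (A : t₁.heart.FullSubcategory) (B : t₂.heart.FullSubcategory) :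
    t.heart ((G.obj A.obj).obj B.obj) :=
  (t.mem_heart_iff _).2 ⟨IsTExact.isLE t₁ t₂ 0 0 A.obj B.obj, IsTExact.isGE t₁ t₂ 0 0 A.obj B.obj⟩

/-- The bifunctor induced on hearts by a t-exact bifunctor, on objects. -/
def heartObj (A : t₁.heart.FullSubcategory) (B : t₂.heart.FullSubcategory) :
    t.heart.FullSubcategory :=
  ⟨(G.obj A.obj).obj B.obj, heart_obj_obj G t₁ t₂ t A B⟩

variable {t₁ t₂} in
/-- The bifunctor induced on hearts by a t-exact bifunctor, on morphisms. -/
def heartMap {A A' : t₁.heart.FullSubcategory} {B B' : t₂.heart.FullSubcategory}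
    (f : A ⟶ A') (g : B ⟶ B') : heartObj G t₁ t₂ t A B ⟶ heartObj G t₁ t₂ t A' B' :=
  ObjectProperty.homMk (bimap G f.hom g.hom)

instance isIso_heartMap {A A' : t₁.heart.FullSubcategory} {B B' : t₂.heart.FullSubcategory}
    (f : A ⟶ A') (g : B ⟶ B') [IsIso f] [IsIso g] : IsIso (heartMap G t f g) := by
  rw [← ObjectProperty.isIso_hom_iff]
  exact isIso_bimap G f.hom g.hom

/-- Change one variable at a time: by t-exactness the fibre of each of the two maps lies in degrees
`≤ -1`, where `H0` does not see it. -/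
lemma isIso_H0_map_bimap_truncLEToH0 (X : C₁) (Y : C₂) :
    IsIso ((H0 t).map (bimap G ((truncLEToH0 t₁).app X) ((truncLEToH0 t₂).app Y))) := by
  rw [← Category.comp_id ((truncLEToH0 t₁).app X), ← Category.id_comp ((truncLEToH0 t₂).app Y),
    bimap_comp, Functor.map_comp]
  obtain ⟨F, f, h, hT, hF⟩ := exists_distinguished_truncLEToH0 t₁ X
  obtain ⟨F', f', h', hT', hF'⟩ := exists_distinguished_truncLEToH0 t₂ Y
  obtain ⟨w, hw⟩ := exists_distinguished_left G hT ((t₂.truncLE 0).obj Y)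
  obtain ⟨w', hw'⟩ := exists_distinguished_right G ((H0 t₁).obj X).obj hT'
  have h₁ := isIso_H0_map_of_isLE t hw (IsTExact.isLE t₁ t₂ (-1) 0 _ _)
  have h₂ := isIso_H0_map_of_isLE t hw' (IsTExact.isLE t₁ t₂ 0 (-1) _ _)
  exact IsIso.comp_isIso' h₁ h₂

/-- Dual argument: the cones now lie in degrees `≥ 1`. -/
lemma isIso_H0_map_bimap_h0ToTruncGE (X : C₁) (Y : C₂) :
    IsIso ((H0 t).map (bimap G ((h0ToTruncGE t₁).app X) ((h0ToTruncGE t₂).app Y))) := by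
  rw [← Category.comp_id ((h0ToTruncGE t₁).app X), ← Category.id_comp ((h0ToTruncGE t₂).app Y),
    bimap_comp, Functor.map_comp]
  obtain ⟨F, f, h, hT, hF⟩ := exists_distinguished_h0ToTruncGE t₁ X
  obtain ⟨F', f', h', hT', hF'⟩ := exists_distinguished_h0ToTruncGE t₂ Y
  obtain ⟨w, hw⟩ := exists_distinguished_left G hT ((H0 t₂).obj Y).obj
  obtain ⟨w', hw'⟩ := exists_distinguished_right G ((t₁.truncGE 0).obj X) hT'
  have h₁ := isIso_H0_map_of_isGE t hw (IsTExact.isGE t₁ t₂ 1 0 _ _)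
  have h₂ := isIso_H0_map_of_isGE t hw' (IsTExact.isGE t₁ t₂ 0 1 _ _)
  exact IsIso.comp_isIso' h₁ h₂

/-- The isomorphism `H⁰(G(τ_{≤ 0} X, τ_{≤ 0} Y)) ≅ G(H⁰(X), H⁰(Y))`. -/
def h0TruncLEIso (X : C₁) (Y : C₂) :
    (H0 t).obj ((G.obj ((t₁.truncLE 0).obj X)).obj ((t₂.truncLE 0).obj Y)) ≅
      heartObj G t₁ t₂ t ((H0 t₁).obj X) ((H0 t₂).obj Y) :=
  @asIso _ _ _ _ _ (isIso_H0_map_bimap_truncLEToH0 G t₁ t₂ t X Y) ≪≫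
    (ιCompH0Iso t).app (heartObj G t₁ t₂ t ((H0 t₁).obj X) ((H0 t₂).obj Y))

/-- The isomorphism `G(H⁰(X), H⁰(Y)) ≅ H⁰(G(τ_{≥ 0} X, τ_{≥ 0} Y))`. -/
def h0TruncGEIso (X : C₁) (Y : C₂) :
    heartObj G t₁ t₂ t ((H0 t₁).obj X) ((H0 t₂).obj Y) ≅
      (H0 t).obj ((G.obj ((t₁.truncGE 0).obj X)).obj ((t₂.truncGE 0).obj Y)) :=
  (ιCompH0Iso t).symm.app (heartObj G t₁ t₂ t ((H0 t₁).obj X) ((H0 t₂).obj Y)) ≪≫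
    @asIso _ _ _ _ _ (isIso_H0_map_bimap_h0ToTruncGE G t₁ t₂ t X Y)

lemma h0TruncLEIso_hom_naturality {X X' : C₁} {Y Y' : C₂} (f : X ⟶ X') (g : Y ⟶ Y') :
    (H0 t).map (bimap G ((t₁.truncLE 0).map f) ((t₂.truncLE 0).map g)) ≫
        (h0TruncLEIso G t₁ t₂ t X' Y').hom =
      (h0TruncLEIso G t₁ t₂ t X Y).hom ≫ heartMap G t ((H0 t₁).map f) ((H0 t₂).map g) := by
  have h₁ : (H0 t).map (bimap G ((t₁.truncLE 0).map f) ((t₂.truncLE 0).map g)) ≫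
        (H0 t).map (bimap G ((truncLEToH0 t₁).app X') ((truncLEToH0 t₂).app Y')) =
      (H0 t).map (bimap G ((truncLEToH0 t₁).app X) ((truncLEToH0 t₂).app Y)) ≫
        (H0 t).map (heartMap G t ((H0 t₁).map f) ((H0 t₂).map g)).hom := by
    rw [← Functor.map_comp, ← bimap_comp, (truncLEToH0 t₁).naturality,
      (truncLEToH0 t₂).naturality, bimap_comp, Functor.map_comp]
    rfl
  have h₂ : (H0 t).map (heartMap G t ((H0 t₁).map f) ((H0 t₂).map g)).hom ≫
      (ιCompH0Iso t).hom.app (heartObj G t₁ t₂ t ((H0 t₁).obj X') ((H0 t₂).obj Y')) =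
      (ιCompH0Iso t).hom.app (heartObj G t₁ t₂ t ((H0 t₁).obj X) ((H0 t₂).obj Y)) ≫
        heartMap G t ((H0 t₁).map f) ((H0 t₂).map g) :=
    (ιCompH0Iso t).hom.naturality (heartMap G t ((H0 t₁).map f) ((H0 t₂).map g))
  exact (Category.assoc _ _ _).symm.trans ((congr_arg (· ≫ _) h₁).trans
    ((Category.assoc _ _ _).trans ((congr_arg (_ ≫ ·) h₂).trans (Category.assoc _ _ _).symm)))

lemma h0TruncGEIso_hom_naturality {X X' : C₁} {Y Y' : C₂} (f : X ⟶ X') (g : Y ⟶ Y') :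
    heartMap G t ((H0 t₁).map f) ((H0 t₂).map g) ≫ (h0TruncGEIso G t₁ t₂ t X' Y').hom =
      (h0TruncGEIso G t₁ t₂ t X Y).hom ≫
        (H0 t).map (bimap G ((t₁.truncGE 0).map f) ((t₂.truncGE 0).map g)) := by
  have h₁ : (H0 t).map (heartMap G t ((H0 t₁).map f) ((H0 t₂).map g)).hom ≫
        (H0 t).map (bimap G ((h0ToTruncGE t₁).app X') ((h0ToTruncGE t₂).app Y')) =
      (H0 t).map (bimap G ((h0ToTruncGE t₁).app X) ((h0ToTruncGE t₂).app Y)) ≫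
        (H0 t).map (bimap G ((t₁.truncGE 0).map f) ((t₂.truncGE 0).map g)) := by
    rw [← Functor.map_comp, ← bimap_comp, ← (h0ToTruncGE t₁).naturality,
      ← (h0ToTruncGE t₂).naturality, bimap_comp, Functor.map_comp]
    rfl
  have h₂ : heartMap G t ((H0 t₁).map f) ((H0 t₂).map g) ≫
      (ιCompH0Iso t).inv.app (heartObj G t₁ t₂ t ((H0 t₁).obj X') ((H0 t₂).obj Y')) =
      (ιCompH0Iso t).inv.app (heartObj G t₁ t₂ t ((H0 t₁).obj X) ((H0 t₂).obj Y)) ≫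
        (H0 t).map (heartMap G t ((H0 t₁).map f) ((H0 t₂).map g)).hom :=
    (ιCompH0Iso t).inv.naturality (heartMap G t ((H0 t₁).map f) ((H0 t₂).map g))
  exact (Category.assoc _ _ _).symm.trans ((congr_arg (· ≫ _) h₂).trans
    ((Category.assoc _ _ _).trans ((congr_arg (_ ≫ ·) h₁).trans (Category.assoc _ _ _).symm)))

/-- Both `τ_{≤ 0} ⟶ H⁰ ⟶ τ_{≥ 0}` and `τ_{≤ 0} ⟶ 𝟭 ⟶ τ_{≥ 0}` are the same map in each variable.
This is what makes `toH0` a section of `fromH0`. -/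
lemma h0TruncLEIso_hom_comp_h0TruncGEIso_hom (X : C₁) (Y : C₂) :
    (h0TruncLEIso G t₁ t₂ t X Y).hom ≫ (h0TruncGEIso G t₁ t₂ t X Y).hom =
      (H0 t).map (bimap G (X' := X) (Y' := Y) ((t₁.truncLEι 0).app X) ((t₂.truncLEι 0).app Y)) ≫
        (H0 t).map (bimap G ((t₁.truncGEπ 0).app X) ((t₂.truncGEπ 0).app Y)) := by
  have h : (H0 t).map (bimap G ((truncLEToH0 t₁).app X) ((truncLEToH0 t₂).app Y)) ≫
      (H0 t).map (bimap G ((h0ToTruncGE t₁).app X) ((h0ToTruncGE t₂).app Y)) =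
      (H0 t).map (bimap G (X' := X) (Y' := Y) ((t₁.truncLEι 0).app X) ((t₂.truncLEι 0).app Y)) ≫
        (H0 t).map (bimap G ((t₁.truncGEπ 0).app X) ((t₂.truncGEπ 0).app Y)) := by
    rw [← Functor.map_comp, ← bimap_comp, truncLEToH0_comp_h0ToTruncGE,
      truncLEToH0_comp_h0ToTruncGE]
    exact (congr_arg _ (bimap_comp ..)).trans ((H0 t).map_comp _ _)
  refine Eq.trans ?_ h
  change (_ ≫ _) ≫ (_ ≫ _) = _
  rw [Category.assoc]
  exact congr_arg (_ ≫ ·) ((ιCompH0Iso t).hom_inv_id_app_assoc _ _)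

/-- The natural morphism `G(H⁰(X), H⁰(Y)) ⟶ H⁰(G(X, Y))`, induced by
`G(τ_{≤ 0} X, τ_{≤ 0} Y) ⟶ G(X, Y)`. -/
def toH0 (X : C₁) (Y : C₂) :
    heartObj G t₁ t₂ t ((H0 t₁).obj X) ((H0 t₂).obj Y) ⟶ (H0 t).obj ((G.obj X).obj Y) :=
  (h0TruncLEIso G t₁ t₂ t X Y).inv ≫
    (H0 t).map (bimap G (X' := X) (Y' := Y) ((t₁.truncLEι 0).app X) ((t₂.truncLEι 0).app Y))

/-- The natural morphism `H⁰(G(X, Y)) ⟶ G(H⁰(X), H⁰(Y))`, induced by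
`G(X, Y) ⟶ G(τ_{≥ 0} X, τ_{≥ 0} Y)`. -/
def fromH0 (X : C₁) (Y : C₂) :
    (H0 t).obj ((G.obj X).obj Y) ⟶ heartObj G t₁ t₂ t ((H0 t₁).obj X) ((H0 t₂).obj Y) :=
  (H0 t).map (bimap G ((t₁.truncGEπ 0).app X) ((t₂.truncGEπ 0).app Y)) ≫
    (h0TruncGEIso G t₁ t₂ t X Y).inv

lemma toH0_comp_fromH0 (X : C₁) (Y : C₂) :
    toH0 G t₁ t₂ t X Y ≫ fromH0 G t₁ t₂ t X Y = 𝟙 _ := by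
  have h := h0TruncLEIso_hom_comp_h0TruncGEIso_hom G t₁ t₂ t X Y
  rw [toH0, Category.assoc, Iso.inv_comp_eq, Category.comp_id]
  refine Eq.trans ?_ ((Iso.eq_comp_inv _).2 h).symm
  exact (Category.assoc _ _ _).symm

lemma toH0_naturality {X X' : C₁} {Y Y' : C₂} (f : X ⟶ X') (g : Y ⟶ Y') :
    heartMap G t ((H0 t₁).map f) ((H0 t₂).map g) ≫ toH0 G t₁ t₂ t X' Y' =
      toH0 G t₁ t₂ t X Y ≫ (H0 t).map (bimap G f g) := by
  have h₁ := h0TruncLEIso_hom_naturality G t₁ t₂ t f g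
  have h₂ : bimap G ((t₁.truncLE 0).map f) ((t₂.truncLE 0).map g) ≫
        bimap G (X' := X') (Y' := Y') ((t₁.truncLEι 0).app X') ((t₂.truncLEι 0).app Y') =
      bimap G (X' := X) (Y' := Y) ((t₁.truncLEι 0).app X) ((t₂.truncLEι 0).app Y) ≫
        bimap G f g := by
    rw [← bimap_comp, ← bimap_comp]
    congr 1
    · exact (t₁.truncLEι 0).naturality f
    · exact (t₂.truncLEι 0).naturality g
  rw [toH0, toH0, Category.assoc, ← Functor.map_comp, ← h₂, Functor.map_comp,
    Iso.eq_inv_comp, ← reassoc_of% h₁, Iso.hom_inv_id_assoc]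

lemma fromH0_naturality {X X' : C₁} {Y Y' : C₂} (f : X ⟶ X') (g : Y ⟶ Y') :
    (H0 t).map (bimap G f g) ≫ fromH0 G t₁ t₂ t X' Y' =
      fromH0 G t₁ t₂ t X Y ≫ heartMap G t ((H0 t₁).map f) ((H0 t₂).map g) := by
  have h₁ := h0TruncGEIso_hom_naturality G t₁ t₂ t f g
  have h₂ : bimap G f g ≫ bimap G ((t₁.truncGEπ 0).app X') ((t₂.truncGEπ 0).app Y') =
      bimap G (X := X) (Y := Y) ((t₁.truncGEπ 0).app X) ((t₂.truncGEπ 0).app Y) ≫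
        bimap G ((t₁.truncGE 0).map f) ((t₂.truncGE 0).map g) := by
    rw [← bimap_comp]
    refine Eq.trans ?_ (bimap_comp ..)
    congr 1
    · exact (t₁.truncGEπ 0).naturality f
    · exact (t₂.truncGEπ 0).naturality g
  have h₃ := congr_arg (H0 t).map h₂
  rw [Functor.map_comp, Functor.map_comp] at h₃
  refine (Category.assoc _ _ _).symm.trans ((congr_arg (· ≫ _) h₃).trans ?_)
  rw [fromH0, Category.assoc, Category.assoc]
  refine congr_arg (_ ≫ ·) ?_
  rw [Iso.eq_inv_comp, ← reassoc_of% h₁, Iso.hom_inv_id, Category.comp_id]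

end Kunneth

/-! ### Shifted triangles and the functors `Hⁿ`. -/

section Shift

variable {C : Type u₁} [Category.{v₁} C] [Preadditive C] [HasZeroObject C] [HasShift C ℤ]
  [∀ n : ℤ, (shiftFunctor C n).Additive] [Pretriangulated C]

lemma exists_distinguished_shift {X Y Z : C} {u : X ⟶ Y} {v : Y ⟶ Z} {w : Z ⟶ X⟦(1 : ℤ)⟧}
    (hT : Triangle.mk u v w ∈ distTriang C) (n : ℤ) :
    ∃ w', Triangle.mk (u⟦n⟧') (v⟦n⟧') w' ∈ distTriang C := by
  obtain ⟨m, h⟩ : ∃ m, Triangle.mk (n.negOnePow • u⟦n⟧') (n.negOnePow • v⟦n⟧') m ∈ distTriang C :=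
    ⟨_, Triangle.shift_distinguished _ hT n⟩
  rcases Int.units_eq_one_or n.negOnePow with hn | hn
  · rw [hn, one_smul, one_smul] at h
    exact ⟨m, h⟩
  -- For odd `n` the signs on the first two maps are absorbed by `-1` on the middle object; the
  -- third map is not prescribed.
  · rw [hn, Units.neg_smul, Units.neg_smul, one_smul, one_smul] at h
    refine ⟨m, isomorphic_distinguished _ h _
      (Triangle.isoMk _ _ (Iso.refl _) (-Iso.refl _) (Iso.refl _) ?_ ?_ ?_)⟩
    · change u⟦n⟧' ≫ (-𝟙 _) = 𝟙 _ ≫ (-u⟦n⟧')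
      simp
    · change v⟦n⟧' ≫ 𝟙 _ = (-𝟙 _) ≫ (-v⟦n⟧')
      simp
    · change m ≫ (𝟙 _)⟦(1 : ℤ)⟧' = 𝟙 _ ≫ m
      simp

variable [IsTriangulated C] (t : TStructure C)

instance (n : ℤ) : (H t n).Additive := by
  dsimp [H]
  infer_instance

lemma H_comp_eq_zero_of_distinguished (n : ℤ) {X Y Z : C} {u : X ⟶ Y} {v : Y ⟶ Z}
    {w : Z ⟶ X⟦(1 : ℤ)⟧} (hT : Triangle.mk u v w ∈ distTriang C)
    {A B : t.heart.FullSubcategory} (f : A ⟶ (H t n).obj Y) (g : (H t n).obj Y ⟶ B)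
    (hf : f ≫ (H t n).map v = 0) (hg : (H t n).map u ≫ g = 0) : f ≫ g = 0 := by
  obtain ⟨w', hw'⟩ := exists_distinguished_shift hT n
  exact comp_eq_zero_of_distinguished t hw' f g hf hg

lemma isZero_H_obj_of_isLE (n : ℤ) (X : C) (a : ℤ) (ha : a < n) [t.IsLE X a] :
    IsZero ((H t n).obj X) := by
  have := t.isLE_shift X a n (a - n)
  exact isZero_H0_obj_of_isLE t _ (a - n) (by lia)

lemma isZero_H_obj_of_isGE (n : ℤ) (X : C) (a : ℤ) (ha : n < a) [t.IsGE X a] :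
    IsZero ((H t n).obj X) := by
  have := t.isGE_shift X a n (a - n)
  exact isZero_H0_obj_of_isGE t _ (a - n) (by lia)

lemma isIso_H_map_truncLEι (n : ℤ) (X : C) :
    IsIso ((H t n).map (Y := X) ((t.truncLEι n).app X)) := by
  obtain ⟨w, hw⟩ := exists_distinguished_shift (t.triangleLEGT_distinguished n X) n
  exact isIso_H0_map_of_isGE t hw (t.isGE_shift ((t.truncGT n).obj X) (n + 1) n 1)

end Shift

/-! ### The decomposition of `Hⁿ(G(X, Y))`. -/

section Kunneth

variable {C₁ : Type u₁} [Category.{v₁} C₁] [Preadditive C₁] [HasZeroObject C₁] [HasShift C₁ ℤ]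
  [∀ n : ℤ, (shiftFunctor C₁ n).Additive] [Pretriangulated C₁] [IsTriangulated C₁]
  {C₂ : Type u₂} [Category.{v₂} C₂] [Preadditive C₂] [HasZeroObject C₂] [HasShift C₂ ℤ]
  [∀ n : ℤ, (shiftFunctor C₂ n).Additive] [Pretriangulated C₂] [IsTriangulated C₂]
  {D : Type u₃} [Category.{v₃} D] [Preadditive D] [HasZeroObject D] [HasShift D ℤ]
  [∀ n : ℤ, (shiftFunctor D n).Additive] [Pretriangulated D] [IsTriangulated D]
  (G : C₁ ⥤ C₂ ⥤ D) [Biexact G]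
  (t₁ : TStructure C₁) (t₂ : TStructure C₂) (t : TStructure D) [IsTExact G t₁ t₂ t]

/-- The family of objects `G(Hᵖ(X), H^q(Y))` for `p + q = n`. -/
abbrev heartFamily (n : ℤ) (X : C₁) (Y : C₂) (i : {pq : ℤ × ℤ // pq.1 + pq.2 = n}) :
    t.heart.FullSubcategory :=
  heartObj G t₁ t₂ t ((H t₁ i.1.1).obj X) ((H t₂ i.1.2).obj Y)

/-- The functoriality of `heartFamily`. -/
abbrev heartFamilyMap (n : ℤ) {X X' : C₁} {Y Y' : C₂} (f : X ⟶ X') (g : Y ⟶ Y')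
    (i : {pq : ℤ × ℤ // pq.1 + pq.2 = n}) :
    heartFamily G t₁ t₂ t n X Y i ⟶ heartFamily G t₁ t₂ t n X' Y' i :=
  heartMap G t ((H t₁ i.1.1).map f) ((H t₂ i.1.2).map g)

variable {n : ℤ}

/-- The natural morphism `G(Hᵖ(X), H^q(Y)) ⟶ Hⁿ(G(X, Y))` for `p + q = n`. -/
def toH (X : C₁) (Y : C₂) (i : {pq : ℤ × ℤ // pq.1 + pq.2 = n}) :
    heartFamily G t₁ t₂ t n X Y i ⟶ (H t n).obj ((G.obj X).obj Y) :=
  toH0 G t₁ t₂ t (X⟦i.1.1⟧) (Y⟦i.1.2⟧) ≫ (H0 t).map (shiftIso G i.1.1 i.1.2 n i.2 X Y).hom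

/-- The natural morphism `Hⁿ(G(X, Y)) ⟶ G(Hᵖ(X), H^q(Y))` for `p + q = n`. -/
def fromH (X : C₁) (Y : C₂) (i : {pq : ℤ × ℤ // pq.1 + pq.2 = n}) :
    (H t n).obj ((G.obj X).obj Y) ⟶ heartFamily G t₁ t₂ t n X Y i :=
  (H0 t).map (shiftIso G i.1.1 i.1.2 n i.2 X Y).inv ≫ fromH0 G t₁ t₂ t (X⟦i.1.1⟧) (Y⟦i.1.2⟧)

lemma toH_comp_fromH (X : C₁) (Y : C₂) (i : {pq : ℤ × ℤ // pq.1 + pq.2 = n}) :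
    toH G t₁ t₂ t X Y i ≫ fromH G t₁ t₂ t X Y i = 𝟙 _ := by
  have h := toH0_comp_fromH0 G t₁ t₂ t (X⟦i.1.1⟧) (Y⟦i.1.2⟧)
  have h' : (H0 t).map (shiftIso G i.1.1 i.1.2 n i.2 X Y).hom ≫
      (H0 t).map (shiftIso G i.1.1 i.1.2 n i.2 X Y).inv ≫
        fromH0 G t₁ t₂ t (X⟦i.1.1⟧) (Y⟦i.1.2⟧) = fromH0 G t₁ t₂ t (X⟦i.1.1⟧) (Y⟦i.1.2⟧) := by
    rw [← Functor.map_comp_assoc, Iso.hom_inv_id, CategoryTheory.Functor.map_id, Category.id_comp]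
  exact (Category.assoc _ _ _).trans ((congr_arg (_ ≫ ·) h').trans h)

lemma toH_naturality {X X' : C₁} {Y Y' : C₂} (f : X ⟶ X') (g : Y ⟶ Y')
    (i : {pq : ℤ × ℤ // pq.1 + pq.2 = n}) :
    heartFamilyMap G t₁ t₂ t n f g i ≫ toH G t₁ t₂ t X' Y' i =
      toH G t₁ t₂ t X Y i ≫ (H t n).map (bimap G f g) := by
  have h₁ := toH0_naturality G t₁ t₂ t (f⟦i.1.1⟧') (g⟦i.1.2⟧')
  have h₂ := congr_arg (H0 t).map (shiftIso_hom_naturality G i.1.1 i.1.2 n i.2 f g)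
  rw [Functor.map_comp, Functor.map_comp] at h₂
  exact (Category.assoc _ _ _).symm.trans ((congr_arg (· ≫ _) h₁).trans
    ((Category.assoc _ _ _).trans ((congr_arg (_ ≫ ·) h₂).trans (Category.assoc _ _ _).symm)))

lemma fromH_naturality {X X' : C₁} {Y Y' : C₂} (f : X ⟶ X') (g : Y ⟶ Y')
    (i : {pq : ℤ × ℤ // pq.1 + pq.2 = n}) :
    (H t n).map (bimap G f g) ≫ fromH G t₁ t₂ t X' Y' i =
      fromH G t₁ t₂ t X Y i ≫ heartFamilyMap G t₁ t₂ t n f g i := by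
  have h₁ := fromH0_naturality G t₁ t₂ t (f⟦i.1.1⟧') (g⟦i.1.2⟧')
  have h₂ : (H0 t).map ((bimap G f g)⟦n⟧') ≫
        (H0 t).map (shiftIso G i.1.1 i.1.2 n i.2 X' Y').inv =
      (H0 t).map (shiftIso G i.1.1 i.1.2 n i.2 X Y).inv ≫
        (H0 t).map (bimap G (f⟦i.1.1⟧') (g⟦i.1.2⟧')) := by
    rw [← Functor.map_comp, ← Functor.map_comp]
    refine congr_arg _ ?_
    rw [Iso.eq_inv_comp, ← Category.assoc, Iso.comp_inv_eq, shiftIso_hom_naturality]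
  exact (Category.assoc _ _ _).symm.trans ((congr_arg (· ≫ _) h₂).trans
    ((Category.assoc _ _ _).trans ((congr_arg (_ ≫ ·) h₁).trans (Category.assoc _ _ _).symm)))

omit [IsTriangulated D] in
lemma isZero_heartFamily_left (X : C₁) (Y : C₂) (i : {pq : ℤ × ℤ // pq.1 + pq.2 = n})
    (hX : IsZero ((H t₁ i.1.1).obj X)) : IsZero (heartFamily G t₁ t₂ t n X Y i) :=
  isZero_of_isZero_obj t (isZero_obj_obj_left G (t₁.heart.ι.map_isZero hX) _)

omit [IsTriangulated D] in
lemma isZero_heartFamily_right (X : C₁) (Y : C₂) (i : {pq : ℤ × ℤ // pq.1 + pq.2 = n})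
    (hY : IsZero ((H t₂ i.1.2).obj Y)) : IsZero (heartFamily G t₁ t₂ t n X Y i) :=
  isZero_of_isZero_obj t (isZero_obj_obj_right G _ (t₂.heart.ι.map_isZero hY))

/-- Some coordinate of `i` is smaller than that of `j`, the two sums being equal. If it is the
first, replacing `X` by `τ_{≤ p} X` with `p = i.1.1` leaves the summand `i` unchanged and kills the
summand `j`; by naturality the composite then factors through zero. The second coordinate is treated
in the same way with `Y`. -/
lemma toH_comp_fromH_of_ne (X : C₁) (Y : C₂) (i j : {pq : ℤ × ℤ // pq.1 + pq.2 = n})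
    (hij : i ≠ j) : toH G t₁ t₂ t X Y i ≫ fromH G t₁ t₂ t X Y j = 0 := by
  have key {X' : C₁} {Y' : C₂} (f : X' ⟶ X) (g : Y' ⟶ Y)
      [IsIso (heartFamilyMap G t₁ t₂ t n f g i)]
      (h : IsZero (heartFamily G t₁ t₂ t n X' Y' j)) :
      toH G t₁ t₂ t X Y i ≫ fromH G t₁ t₂ t X Y j = 0 := by
    rw [← cancel_epi (heartFamilyMap G t₁ t₂ t n f g i), reassoc_of% toH_naturality G t₁ t₂ t f g, fromH_naturality,
      h.eq_of_tgt (fromH G t₁ t₂ t X' Y' j) 0, zero_comp, comp_zero, comp_zero]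
  have hi := i.2
  have hj := j.2
  have : i.1.1 < j.1.1 ∨ i.1.2 < j.1.2 := by
    by_contra! h
    exact hij (Subtype.ext (Prod.ext (by lia) (by lia)))
  rcases this with h | h
  · have := isIso_H_map_truncLEι t₁ i.1.1 X
    exact key (X' := (t₁.truncLE i.1.1).obj X) ((t₁.truncLEι i.1.1).app X) (𝟙 Y)
      (isZero_heartFamily_left G t₁ t₂ t _ _ _ (isZero_H_obj_of_isLE t₁ _ _ i.1.1 h))
  · have := isIso_H_map_truncLEι t₂ i.1.2 Y
    exact key (Y' := (t₂.truncLE i.1.2).obj Y) (𝟙 X) ((t₂.truncLEι i.1.2).app Y)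
      (isZero_heartFamily_right G t₁ t₂ t _ _ _ (isZero_H_obj_of_isLE t₂ _ _ i.1.2 h))

lemma sum_fromH_comp_toH_naturality {X X' : C₁} {Y Y' : C₂} (f : X ⟶ X') (g : Y ⟶ Y')
    (s : Finset {pq : ℤ × ℤ // pq.1 + pq.2 = n}) :
    (H t n).map (bimap G f g) ≫ ∑ i ∈ s, fromH G t₁ t₂ t X' Y' i ≫ toH G t₁ t₂ t X' Y' i =
      (∑ i ∈ s, fromH G t₁ t₂ t X Y i ≫ toH G t₁ t₂ t X Y i) ≫ (H t n).map (bimap G f g) := by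
  rw [Preadditive.comp_sum, Preadditive.sum_comp]
  refine Finset.sum_congr rfl fun i _ ↦ ?_
  rw [reassoc_of% fromH_naturality G t₁ t₂ t f g, toH_naturality, Category.assoc]

/-- After the shifts both objects lie in degrees `≤ 0`, so the truncation maps defining `toH0` are
already isomorphisms. -/
lemma isIso_toH (X : C₁) (Y : C₂) (i : {pq : ℤ × ℤ // pq.1 + pq.2 = n})
    [t₁.IsLE X i.1.1] [t₂.IsLE Y i.1.2] : IsIso (toH G t₁ t₂ t X Y i) := by
  have := t₁.isLE_shift X i.1.1 i.1.1 0
  have := t₂.isLE_shift Y i.1.2 i.1.2 0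
  have h₁ : IsIso ((t₁.truncLEι 0).app (X⟦i.1.1⟧)) := inferInstance
  have h₂ : IsIso ((t₂.truncLEι 0).app (Y⟦i.1.2⟧)) := inferInstance
  have h₃ := @isIso_bimap _ _ _ _ _ _ G _ _ _ _ _ _ h₁ h₂
  have h₄ : IsIso (toH0 G t₁ t₂ t (X⟦i.1.1⟧) (Y⟦i.1.2⟧)) :=
    IsIso.comp_isIso' (Iso.isIso_inv _) (@Functor.map_isIso _ _ _ _ _ _ (H0 t) _ h₃)
  exact IsIso.comp_isIso' h₄
    (Functor.map_isIso (H0 t) (shiftIso G i.1.1 i.1.2 n i.2 X Y).hom)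

variable (n) in
/-- The property that the morphisms `toH` and `fromH` decompose `Hⁿ(G(X, Y))` as a finite
direct sum. -/
def Decomposes (X : C₁) (Y : C₂) : Prop :=
  ∃ s : Finset {pq : ℤ × ℤ // pq.1 + pq.2 = n},
    ∑ i ∈ s, fromH G t₁ t₂ t X Y i ≫ toH G t₁ t₂ t X Y i = 𝟙 _

variable {G t₁ t₂ t}

lemma decomposes_of_isZero {X : C₁} {Y : C₂} (h : IsZero ((H t n).obj ((G.obj X).obj Y))) :
    Decomposes G t₁ t₂ t n X Y :=
  ⟨∅, h.eq_of_src _ _⟩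

lemma Decomposes.of_distinguished {X X' X'' : C₁} {Y Y' Y'' : C₂} (f : X ⟶ X') (f' : X' ⟶ X'')
    (g : Y ⟶ Y') (g' : Y' ⟶ Y'')
    (hT : ∃ w, Triangle.mk (bimap G f g) (bimap G f' g') w ∈ distTriang D)
    (h : Decomposes G t₁ t₂ t n X Y) (h'' : Decomposes G t₁ t₂ t n X'' Y'') :
    Decomposes G t₁ t₂ t n X' Y' := by
  classical
  obtain ⟨w, hw⟩ := hT
  obtain ⟨s, hs⟩ := h
  obtain ⟨s'', hs''⟩ := h''
  replace hs := sum_eq_id_of_subset (toH_comp_fromH_of_ne G t₁ t₂ t X Y)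
    (s.subset_union_left (s₂ := s'')) hs
  replace hs'' := sum_eq_id_of_subset (toH_comp_fromH_of_ne G t₁ t₂ t X'' Y'')
    (s.subset_union_right (s₂ := s'')) hs''
  refine ⟨s ∪ s'', ?_⟩
  have h₀ := sum_comp_sum (toH_comp_fromH G t₁ t₂ t X' Y') (toH_comp_fromH_of_ne G t₁ t₂ t X' Y')
    (s ∪ s'')
  have h₁ : (H t n).map (bimap G f g) ≫
      ∑ i ∈ s ∪ s'', fromH G t₁ t₂ t X' Y' i ≫ toH G t₁ t₂ t X' Y' i =
        (H t n).map (bimap G f g) := by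
    rw [sum_fromH_comp_toH_naturality, hs, Category.id_comp]
  have h₂ : (∑ i ∈ s ∪ s'', fromH G t₁ t₂ t X' Y' i ≫ toH G t₁ t₂ t X' Y' i) ≫
      (H t n).map (bimap G f' g') = (H t n).map (bimap G f' g') := by
    rw [← sum_fromH_comp_toH_naturality, hs'', Category.comp_id]
  generalize (∑ i ∈ s ∪ s'', fromH G t₁ t₂ t X' Y' i ≫ toH G t₁ t₂ t X' Y' i) = e at h₀ h₁ h₂ ⊢
  -- By `h₁` and `h₂`, `𝟙 - e` composes to zero with `Hⁿ` of both maps of the triangle, so its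
  -- square vanishes; as `e` is idempotent, that square is `𝟙 - e` itself.
  have h₃ := H_comp_eq_zero_of_distinguished t n hw (𝟙 _ - e) (𝟙 _ - e)
    (by rw [Preadditive.sub_comp, h₂, Category.id_comp, sub_self])
    (by rw [Preadditive.comp_sub, h₁, Category.comp_id, sub_self])
  rw [Preadditive.sub_comp, Preadditive.comp_sub, Preadditive.comp_sub, h₀, Category.id_comp,
    Category.id_comp, Category.comp_id, sub_self, sub_zero, sub_eq_zero] at h₃
  exact h₃.symm

/-- `G(X, Y)` is concentrated in degree `a + b`. Thus either `Hⁿ` vanishes and the empty sum works,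
or `n = a + b` and the single index `(a, b)` suffices, `toH` being invertible there. -/
lemma decomposes_of_isLE_of_isGE (a b : ℤ) (X : C₁) (Y : C₂) [t₁.IsLE X a] [t₁.IsGE X a]
    [t₂.IsLE Y b] [t₂.IsGE Y b] : Decomposes G t₁ t₂ t n X Y := by
  have := IsTExact.isLE (G := G) t₁ t₂ (t := t) a b X Y
  have := IsTExact.isGE (G := G) t₁ t₂ (t := t) a b X Y
  rcases lt_trichotomy (a + b) n with h | h | h
  · exact decomposes_of_isZero (isZero_H_obj_of_isLE t n _ (a + b) h)
  · have := isIso_toH G t₁ t₂ t X Y ⟨(a, b), h⟩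
    refine ⟨{⟨(a, b), h⟩}, ?_⟩
    rw [Finset.sum_singleton, ← cancel_epi (toH G t₁ t₂ t X Y ⟨(a, b), h⟩),
      ← Category.assoc, toH_comp_fromH, Category.id_comp, Category.comp_id]
  · exact decomposes_of_isZero (isZero_H_obj_of_isGE t n _ (a + b) h)

lemma decomposes_of_isBounded (ht₁ : IsBounded t₁) (ht₂ : IsBounded t₂) (X : C₁) (Y : C₂) :
    Decomposes G t₁ t₂ t n X Y := by
  obtain ⟨⟨a, _⟩, ⟨a', _⟩⟩ := ht₁ X
  obtain ⟨⟨b, _⟩, ⟨b', _⟩⟩ := ht₂ Y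
  refine of_isGE_of_isLE t₁ (fun X ↦ Decomposes G t₁ t₂ t n X Y) ?_ a a' ?_ ?_ X
  · intro T hT h h''
    exact .of_distinguished _ _ _ _ (exists_distinguished_left G hT Y) h h''
  · intro c _ _ X _ _
    refine of_isGE_of_isLE t₂ (fun Y ↦ Decomposes G t₁ t₂ t n X Y) ?_ b b' ?_ ?_ Y
    · intro T hT h h''
      exact .of_distinguished _ _ _ _ (exists_distinguished_right G X hT) h h''
    · exact fun d _ _ Y _ _ ↦ decomposes_of_isLE_of_isGE c d X Y
    · exact fun Y hY ↦ decomposes_of_isZero ((H t n).map_isZero (isZero_obj_obj_right G X hY))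
  · exact fun X hX ↦ decomposes_of_isZero ((H t n).map_isZero (isZero_obj_obj_left G hX Y))

variable (G t) in
/-- The cofan given by the morphisms `toH` is a coproduct cofan. -/
def isColimitToH (ht₁ : IsBounded t₁) (ht₂ : IsBounded t₂) (X : C₁) (Y : C₂) :
    IsColimit (Cofan.mk ((H t n).obj ((G.obj X).obj Y)) (toH G t₁ t₂ t X Y)) :=
  isColimitOfSumEqId (toH_comp_fromH G t₁ t₂ t X Y) (toH_comp_fromH_of_ne G t₁ t₂ t X Y)
    (decomposes_of_isBounded ht₁ ht₂ X Y).choose (decomposes_of_isBounded ht₁ ht₂ X Y).choose_spec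

end Kunneth

end Kunneth

end

/-! ### The Künneth formula for the module product. -/

theorem proposition3p3
    {T : Type u₁} [Category.{v₁} T] [Preadditive T] [HasZeroObject T] [HasShift T ℤ]
    [∀ n : ℤ, (shiftFunctor T n).Additive] [Pretriangulated T] [IsTriangulated T]
    [MonoidalCategory T] [Kunneth.MonoidalTriangulated T]
    {K : Type u₂} [Category.{v₂} K] [Preadditive K] [HasZeroObject K] [HasShift K ℤ]
    [∀ n : ℤ, (shiftFunctor K n).Additive] [Pretriangulated K] [IsTriangulated K]
    [MonoidalLeftAction T K] [Kunneth.TriangulatedModule T K]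
    (t : TStructure T) (ht : Kunneth.IsBounded t) (htt : Kunneth.TensorCompatible t)
    (t' : TStructure K) (ht' : Kunneth.IsBounded t') (h : Kunneth.ActionCompatible t t')
    (n : ℤ) :
    ∃ (_ : ∀ (X : T) (M : K), HasCoproduct (Kunneth.summand h n X M))
      (e : ∀ (X : T) (M : K), (Kunneth.H t' n).obj (X ⊙ₗ M) ≅ ∐ Kunneth.summand h n X M),
      ∀ {X X' : T} {M M' : K} (f : X ⟶ X') (g : M ⟶ M'),
        (Kunneth.H t' n).map (f ⊙ₗₘ g) ≫ (e X' M').hom =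
          (e X M).hom ≫ Limits.Sigma.map (Kunneth.summandMap h n f g) := by
  let G := MonoidalLeftAction.curriedAction T K
  have : Kunneth.IsTExact G t t' t' := .of_heart G ht ht' h
  let φ (X : T) (M : K) (i : {pq : ℤ × ℤ // pq.1 + pq.2 = n}) :
      Kunneth.summand h n X M i ⟶ (Kunneth.H t' n).obj (X ⊙ₗ M) :=
    Kunneth.toH G t t' t' X M i
  have hφ (X : T) (M : K) : IsColimit (Cofan.mk _ (φ X M)) :=
    Kunneth.isColimitToH G t' ht ht' X M
  have φ_naturality {X X' : T} {M M' : K} (f : X ⟶ X') (g : M ⟶ M')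
      (i : {pq : ℤ × ℤ // pq.1 + pq.2 = n}) :
      Kunneth.summandMap h n f g i ≫ φ X' M' i =
        φ X M i ≫ (Kunneth.H t' n).map (f ⊙ₗₘ g) := by
    have h₁ (i : {pq : ℤ × ℤ // pq.1 + pq.2 = n}) :
        Kunneth.heartFamilyMap G t t' t' n f g i = Kunneth.summandMap h n f g i := by
      ext
      exact (MonoidalLeftAction.actionHom_def _ _).symm
    rw [← h₁, MonoidalLeftAction.actionHom_def]
    exact Kunneth.toH_naturality G t t' t' f g i
  have hc (X : T) (M : K) : HasCoproduct (Kunneth.summand h n X M) := ⟨⟨⟨_, hφ X M⟩⟩⟩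
  refine ⟨hc, fun X M ↦ (hφ X M).coconePointUniqueUpToIso (coproductIsCoproduct _), ?_⟩
  intro X X' M M' f g
  have hι (X : T) (M : K) (i : {pq : ℤ × ℤ // pq.1 + pq.2 = n}) :
      φ X M i ≫ ((hφ X M).coconePointUniqueUpToIso (coproductIsCoproduct _)).hom =
        Sigma.ι (Kunneth.summand h n X M) i :=
    (hφ X M).comp_coconePointUniqueUpToIso_hom (coproductIsCoproduct _) ⟨i⟩
  -- Naturality is tested on the injections `φ`, where it reduces to naturality of `toH`.
  refine Cofan.IsColimit.hom_ext (hφ X M) _ _ fun i ↦ ?_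
  change φ X M i ≫ _ ≫ _ = φ X M i ≫ _ ≫ _
  rw [← reassoc_of% φ_naturality, hι, reassoc_of% hι, Sigma.ι_map]
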